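/- Let $K$ be a field and let $f(X,Y)=\sum_{i=0}^{n}a_iY^i$ and $g(X,Y)=\sum_{i=0}^{m}b_iY^i$ be polynomials in $K[X,Y]$, where $n,m\ge 1$, $a_0,\dots,a_n,b_0,\dots,b_m\in K[X]$ and $a_0a_nb_0b_m\neq 0$. Assume that neither $f$ nor $g$ is divisible by a nonconstant polynomial of $K[X]$. Put $$A=\deg a_0-\max\{\deg a_1,\dots,\deg a_n\},\qquad B=\max\{\deg b_0,\dots,\deg b_{m-1}\}-\deg b_m .$$ For a nonzero polynomial $p\in K[X]$ let $\Omega(p)$ denote the number of irreducible factors of $p$ in $K[X]$, counted with multiplicities and up to multiplication by nonzero constants, and let $\mathrm{Res}_Y(f,g)\in K[X]$ denote the resultant of $f$ and $g$ with respect to $Y$. If $$\min\{A,\tfrac{A}{n}\}>\max\{B,\tfrac{B}{m}\}$$ and if $\min\{\deg a_0,\deg b_m\}>\deg d$ for some divisor $d\in K[X]$ of $\mathrm{Res}_Y(f,g)$, then each of $f$ and $g$ is a product of at most $\Omega\bigl(\mathrm{Res}_Y(f,g)/d\bigr)$ irreducible factors in $K[X,Y]$, counted with multiplicities. -/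

import Mathlib

open Polynomial
open scoped Polynomial.Bivariate

noncomputable section

/-- The number of irreducible factors of a nonzero `p ∈ K[X]`, counted with multiplicities and up to
multiplication by nonzero constants. -/
def bigOmega {K : Type*} [Field K] (p : K[X]) : ℕ :=
  Multiset.card (UniqueFactorizationMonoid.factors p)

/-- `A = deg a₀ - max {deg a₁, …, deg aₙ}` for `f = ∑ aᵢ Yⁱ ∈ K[X][Y]`, `n = deg_Y f ≥ 1`.
As `aₙ ≠ 0`, giving the zero polynomial degree `0` does not change the maximum. -/
def lowGap {K : Type*} [Field K] (f : K[X][Y]) : ℤ :=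
  ((f.coeff 0).natDegree : ℤ) -
    (((Finset.Icc 1 f.natDegree).sup fun i => (f.coeff i).natDegree : ℕ) : ℤ)

/-- `B = max {deg b₀, …, deg bₘ₋₁} - deg bₘ` for `g = ∑ bᵢ Yⁱ ∈ K[X][Y]`, `m = deg_Y g ≥ 1`.
If `b₀ ≠ 0`, giving the zero polynomial degree `0` does not change the maximum. -/
def highGap {K : Type*} [Field K] (g : K[X][Y]) : ℤ :=
  (((Finset.range g.natDegree).sup fun i => (g.coeff i).natDegree : ℕ) : ℤ) -
    ((g.coeff g.natDegree).natDegree : ℤ)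

/-- `F` is a product of at most `k` irreducible elements, multiplicities counted. -/
def IsProductOfAtMost {R : Type*} [CommRing R] (k : ℕ) (F : R) : Prop :=
  ∃ s : Multiset R, (∀ p ∈ s, Irreducible p) ∧ s.prod = F ∧ Multiset.card s ≤ k

end

/-! Extend the degree to a valuation on an algebraic closure of `K(X)`. Ultrametric estimates bound
the roots of `f` from below in terms of `A` and those of `g` from above in terms of `B`, and the
hypothesis on `A`, `B` makes every root of `f` strictly larger than every root of `g`
(`valuation_root_lt_valuation_root`). So for `p ∣ f` and `q ∣ g` each difference of roots in the
product formula for `Res(p, q)` is as large as the root of `p`, which gives the exact degree of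
`Res(p, q)` (`natDegree_resultant_of_gap_lt`).

By multiplicativity, `Res(f, g)` is the product of `Res(p, g)` over the irreducible factors `p` of
`f`, each of degree at least `deg b_m > deg d`. Cancelling `d` therefore exhausts none of them, and
each leaves an irreducible factor in `Res(f, g) / d`. For `g` the argument is dual, with `deg a_0`.
-/

/-! ### A valuation extending the degree -/

/-- Over any field containing `K[X]` there is a valuation that restricts to a power of a fixed
element `t > 1` with exponent the degree. -/
theorem exists_valuation_extending_natDegree (K L : Type*) [Field K] [Field L]
    (φ : K[X] →+* L) (hφ : Function.Injective φ) :
    ∃ (V : ValuationSubring L) (t : V.ValueGroup), 1 < t ∧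
      ∀ p : K[X], p ≠ 0 → V.valuation (φ p) = t ^ p.natDegree := by
  let : Algebra K L := (φ.comp C).toAlgebra
  have haeval : ∀ p : K[X], aeval (φ X) p = φ p := by
    intro p
    have : (aeval (φ X) : K[X] →ₐ[K] L).toRingHom = φ := by
      apply Polynomial.ringHom_ext
      · intro a
        simp [RingHom.algebraMap_toAlgebra]
      · simp
    exact congrArg (fun ψ : K[X] →+* L => ψ p) this
  have htr : φ X ∉ (integralClosure K L).toSubring := by
    intro h
    obtain ⟨p, hp, hp0⟩ : IsIntegral K (φ X) := h
    rw [← aeval_def, haeval, map_eq_zero_iff φ hφ] at hp0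
    exact hp.ne_zero hp0
  have : IsIntegrallyClosedIn (integralClosure K L).toSubring L :=
    inferInstanceAs (IsIntegrallyClosedIn (integralClosure K L) L)
  -- `φ X` is transcendental over `K`, so some valuation ring contains `K` but not `φ X`: nonzero
  -- constants get value `1`, and `t = V.valuation (φ X)` exceeds `1`.
  obtain ⟨V, hV, hX⟩ := Subring.exists_le_valuationSubring_of_isIntegrallyClosedIn htr
  have ht : 1 < V.valuation (φ X) := by
    rwa [← not_le, V.valuation_le_one_iff]
  have hle : ∀ a : K, V.valuation (φ (C a)) ≤ 1 := fun a =>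
    (V.valuation_le_one_iff _).2 (hV ((integralClosure K L).algebraMap_mem a))
  have hone : ∀ a : K, a ≠ 0 → V.valuation (φ (C a)) = 1 := by
    intro a ha
    refine le_antisymm (hle a) ?_
    have h1 : V.valuation (φ (C a)) * V.valuation (φ (C a⁻¹)) = 1 := by
      rw [← map_mul, ← map_mul, ← C_mul, mul_inv_cancel₀ ha]
      simp
    calc 1 = V.valuation (φ (C a)) * V.valuation (φ (C a⁻¹)) := h1.symm
      _ ≤ V.valuation (φ (C a)) * 1 := by gcongr; exact hle _
      _ = _ := mul_one _
  refine ⟨V, V.valuation (φ X), ht, fun p hp => ?_⟩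
  have hterm : ∀ i, V.valuation (φ (C (p.coeff i) * X ^ i)) ≤ V.valuation (φ X) ^ i := by
    intro i
    rw [map_mul, map_mul, map_pow, map_pow]
    exact mul_le_of_le_one_left' (hle _)
  have hlead : V.valuation (φ (C p.leadingCoeff * X ^ p.natDegree)) =
      V.valuation (φ X) ^ p.natDegree := by
    rw [map_mul, map_mul, map_pow, map_pow, hone _ (leadingCoeff_ne_zero.2 hp), one_mul]
  conv_lhs => rw [p.as_sum_range_C_mul_X_pow, Finset.sum_range_succ, map_add, map_sum]
  rw [Valuation.map_add_eq_of_lt_right]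
  · exact hlead
  · rw [coeff_natDegree, hlead]
    refine Valuation.map_sum_lt' _ (pow_pos (zero_lt_one.trans ht) _) fun i hi => ?_
    exact (hterm i).trans_lt (pow_lt_pow_right₀ ht (Finset.mem_range.1 hi))

/-! ### Bounds for the valuations of roots -/

section RootBounds

variable {K L Γ : Type*} [Field K] [Field L] [LinearOrderedCommGroupWithZero Γ]
  {v : Valuation L Γ} {t : Γ} {φ : K[X] →+* L}

theorem valuation_le_pow_of_natDegree_le (ht : 1 < t)
    (hv : ∀ p : K[X], p ≠ 0 → v (φ p) = t ^ p.natDegree) {p : K[X]} {N : ℕ}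
    (hp : p.natDegree ≤ N) : v (φ p) ≤ t ^ N := by
  rcases eq_or_ne p 0 with rfl | h
  · simp
  · rw [hv p h]
    exact pow_le_pow_right₀ ht.le hp

/-- Lower bound for a root, when the constant coefficient has large degree. -/
theorem zpow_lowGap_le_of_root (ht : 1 < t)
    (hv : ∀ p : K[X], p ≠ 0 → v (φ p) = t ^ p.natDegree) {f : K[X][Y]} (h0 : f.coeff 0 ≠ 0)
    {x : L} (hx : f.eval₂ φ x = 0) :
    (1 ≤ v x ∧ t ^ lowGap f ≤ v x ^ f.natDegree) ∨ (v x < 1 ∧ t ^ lowGap f ≤ v x) := by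
  have ht0 : t ≠ 0 := (zero_lt_one.trans ht).ne'
  set M := (Finset.Icc 1 f.natDegree).sup fun i => (f.coeff i).natDegree with hM
  have hbound : ∀ c : Γ, (∀ i ∈ Finset.Icc 1 f.natDegree, v x ^ i ≤ c) → t ^ lowGap f ≤ c := by
    intro c hc
    have key : v (φ (f.coeff 0)) ≤ t ^ M * c := by
      rw [eval₂_eq_sum_range, Finset.sum_range_succ', pow_zero, mul_one] at hx
      rw [eq_neg_of_add_eq_zero_right hx, Valuation.map_neg]
      refine v.map_sum_le fun i hi => ?_
      have hi' : i + 1 ∈ Finset.Icc 1 f.natDegree := by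
        simp only [Finset.mem_range, Finset.mem_Icc] at hi ⊢
        omega
      rw [map_mul, map_pow]
      exact mul_le_mul' (valuation_le_pow_of_natDegree_le ht hv
        (Finset.le_sup (f := fun i => (f.coeff i).natDegree) hi')) (hc _ hi')
    rw [hv _ h0] at key
    rw [lowGap, ← hM, zpow_sub₀ ht0, zpow_natCast, zpow_natCast,
      div_le_iff₀ (pow_pos (zero_lt_one.trans ht) _), mul_comm]
    exact key
  rcases le_or_gt 1 (v x) with h | h
  · exact Or.inl ⟨h, hbound _ fun i hi => pow_le_pow_right₀ h (Finset.mem_Icc.1 hi).2⟩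
  · exact Or.inr ⟨h, hbound _ fun i hi =>
      pow_le_of_le_one zero_le h.le (by have := (Finset.mem_Icc.1 hi).1; omega)⟩

/-- Upper bound for a root, when the leading coefficient has large degree. -/
theorem le_zpow_highGap_of_root (ht : 1 < t)
    (hv : ∀ p : K[X], p ≠ 0 → v (φ p) = t ^ p.natDegree) {g : K[X][Y]} (hg : 1 ≤ g.natDegree)
    {x : L} (hx : g.eval₂ φ x = 0) :
    (1 ≤ v x ∧ v x ≤ t ^ highGap g) ∨ (v x < 1 ∧ v x ^ g.natDegree ≤ t ^ highGap g) := by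
  have ht0 : t ≠ 0 := (zero_lt_one.trans ht).ne'
  have hg0 : g.coeff g.natDegree ≠ 0 := by
    rw [coeff_natDegree, leadingCoeff_ne_zero]
    rintro rfl
    simp at hg
  set M := (Finset.range g.natDegree).sup fun i => (g.coeff i).natDegree with hM
  have hbound : ∀ c : Γ, (∀ i ∈ Finset.range g.natDegree, v x ^ i ≤ c) →
      v x ^ g.natDegree ≤ t ^ highGap g * c := by
    intro c hc
    have key : v (φ (g.coeff g.natDegree)) * v x ^ g.natDegree ≤ t ^ M * c := by
      rw [← map_pow, ← map_mul]
      rw [eval₂_eq_sum_range, Finset.sum_range_succ] at hx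
      rw [eq_neg_of_add_eq_zero_right hx, Valuation.map_neg]
      refine v.map_sum_le fun i hi => ?_
      rw [map_mul, map_pow]
      exact mul_le_mul' (valuation_le_pow_of_natDegree_le ht hv
        (Finset.le_sup (f := fun i => (g.coeff i).natDegree) hi)) (hc _ hi)
    rw [hv _ hg0] at key
    rw [highGap, ← hM, zpow_sub₀ ht0, zpow_natCast, zpow_natCast, div_mul_eq_mul_div,
      le_div_iff₀ (pow_pos (zero_lt_one.trans ht) _), mul_comm]
    exact key
  rcases le_or_gt 1 (v x) with h | h
  · refine Or.inl ⟨h, ?_⟩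
    have := hbound (v x ^ (g.natDegree - 1)) fun i hi =>
      pow_le_pow_right₀ h (by have := Finset.mem_range.1 hi; omega)
    obtain ⟨k, hk⟩ : ∃ k, g.natDegree = k + 1 := ⟨g.natDegree - 1, by omega⟩
    rw [hk, Nat.add_sub_cancel, pow_succ'] at this
    exact le_of_mul_le_mul_right this (pow_pos (zero_lt_one.trans_le h) _)
  · refine Or.inr ⟨h, ?_⟩
    have := hbound 1 fun i _ => pow_le_one₀ zero_le h.le
    rwa [mul_one] at this

theorem valuation_root_lt_valuation_root (ht : 1 < t)
    (hv : ∀ p : K[X], p ≠ 0 → v (φ p) = t ^ p.natDegree) {f g : K[X][Y]}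
    (hn : 1 ≤ f.natDegree) (hm : 1 ≤ g.natDegree) (h0 : f.coeff 0 ≠ 0)
    (hAB : max (highGap g : ℚ) ((highGap g : ℚ) / (g.natDegree : ℚ)) <
      min (lowGap f : ℚ) ((lowGap f : ℚ) / (f.natDegree : ℚ)))
    {x y : L} (hx : f.eval₂ φ x = 0) (hy : g.eval₂ φ y = 0) : v y < v x := by
  have hn' : (0 : ℚ) < f.natDegree := by exact_mod_cast hn
  have hm' : (0 : ℚ) < g.natDegree := by exact_mod_cast hm
  obtain ⟨h1, h2, h3⟩ : highGap g < lowGap f ∧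
      highGap g * f.natDegree < lowGap f ∧ highGap g < lowGap f * g.natDegree := by
    rw [lt_min_iff, max_lt_iff, max_lt_iff, lt_div_iff₀ hn', div_lt_iff₀ hm'] at hAB
    exact ⟨by exact_mod_cast hAB.1.1, by exact_mod_cast hAB.2.1,
      by exact_mod_cast hAB.1.2⟩
  -- `h2` serves when both values are at least `1`, `h3` when both are below `1`, and `h1` when `v x
  -- < 1 ≤ v y`.
  rcases zpow_lowGap_le_of_root ht hv h0 hx with ⟨hx1, hx2⟩ | ⟨hx1, hx2⟩ <;>
    rcases le_zpow_highGap_of_root ht hv hm hy with ⟨hy1, hy2⟩ | ⟨hy1, hy2⟩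
  · refine lt_of_pow_lt_pow_left₀ f.natDegree zero_le ?_
    calc v y ^ f.natDegree ≤ (t ^ highGap g) ^ f.natDegree := pow_le_pow_left₀ zero_le hy2 _
      _ = t ^ (highGap g * f.natDegree) := by rw [zpow_mul, zpow_natCast]
      _ < t ^ lowGap f := zpow_lt_zpow_right₀ ht h2
      _ ≤ _ := hx2
  · exact hy1.trans_le hx1
  · exact hy2.trans_lt ((zpow_lt_zpow_right₀ ht h1).trans_le hx2)
  · refine lt_of_pow_lt_pow_left₀ g.natDegree zero_le ?_
    calc v y ^ g.natDegree ≤ t ^ highGap g := hy2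
      _ < t ^ (lowGap f * g.natDegree) := zpow_lt_zpow_right₀ ht h3
      _ = (t ^ lowGap f) ^ g.natDegree := by rw [zpow_mul, zpow_natCast]
      _ ≤ _ := pow_le_pow_left₀ zero_le hx2 _

end RootBounds

/-! ### The valuation of a resultant -/

/-- If every root of `p` has larger valuation than every root of `q`, the valuation of the
resultant is determined by the constant coefficient of `p` and the leading coefficient of `q`. -/
theorem valuation_resultant_of_roots_lt {L Γ : Type*} [Field L]
    [LinearOrderedCommGroupWithZero Γ] (v : Valuation L Γ) {p q : L[X]}
    (hp : p.Splits) (hq : q.Splits)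
    (h : ∀ x ∈ p.roots, ∀ y ∈ q.roots, v y < v x) :
    v (resultant p q p.natDegree q.natDegree) =
      v (p.coeff 0) ^ q.natDegree * v q.leadingCoeff ^ p.natDegree := by
  -- Since `v y < v x`, each factor `x - y` of `q(x)` has value `v x`.
  have heval : ∀ x ∈ p.roots, v (q.eval x) = v q.leadingCoeff * v x ^ q.natDegree := by
    intro x hx
    rw [hq.eval_eq_prod_roots, map_mul, map_multiset_prod, Multiset.map_map]
    congr 1
    rw [Multiset.map_congr rfl (f := v ∘ (x - ·)) (g := fun _ => v x)
      (fun y hy => Valuation.map_sub_eq_of_lt_left v (h x hx y hy)), Multiset.map_const',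
      Multiset.prod_replicate, hq.natDegree_eq_card_roots]
  rw [resultant_eq_prod_eval p q _ le_rfl hp, hp.coeff_zero_eq_leadingCoeff_mul_prod_roots,
    map_mul, map_pow, map_multiset_prod, Multiset.map_map, Multiset.map_congr rfl (f := v ∘ q.eval) heval,
    Multiset.prod_map_mul, Multiset.map_const', Multiset.prod_replicate, Multiset.prod_map_pow,
    map_mul, map_mul, map_pow, Valuation.map_neg, map_one, one_pow, one_mul, map_multiset_prod,
    ← hp.natDegree_eq_card_roots, mul_pow]
  rw [mul_assoc, mul_comm (v q.leadingCoeff ^ _)]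

theorem natDegree_resultant_of_gap_lt {K : Type*} [Field K] {f g : K[X][Y]}
    (hn : 1 ≤ f.natDegree) (hm : 1 ≤ g.natDegree) (h0 : f.coeff 0 ≠ 0)
    (hAB : max (highGap g : ℚ) ((highGap g : ℚ) / (g.natDegree : ℚ)) <
      min (lowGap f : ℚ) ((lowGap f : ℚ) / (f.natDegree : ℚ)))
    {p q : K[X][Y]} (hp : p ∣ f) (hq : q ∣ g) :
    resultant p q p.natDegree q.natDegree ≠ 0 ∧
    (resultant p q p.natDegree q.natDegree).natDegree =
      (p.coeff 0).natDegree * q.natDegree + q.leadingCoeff.natDegree * p.natDegree := by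
  let L := AlgebraicClosure (FractionRing K[X])
  let φ : K[X] →+* L := (algebraMap (FractionRing K[X]) L).comp (algebraMap K[X] _)
  have hφ : Function.Injective φ :=
    (algebraMap (FractionRing K[X]) L).injective.comp (IsFractionRing.injective K[X] _)
  obtain ⟨V, t, ht, hv⟩ := exists_valuation_extending_natDegree K L φ hφ
  have ht0 : t ≠ 0 := (zero_lt_one.trans ht).ne'
  have hp0 : p.coeff 0 ≠ 0 := by
    obtain ⟨r, rfl⟩ := hp
    rw [mul_coeff_zero] at h0
    exact left_ne_zero_of_mul h0
  have hq0 : q.leadingCoeff ≠ 0 := by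
    rw [leadingCoeff_ne_zero]
    rintro rfl
    rw [zero_dvd_iff] at hq
    simp [hq] at hm
  have key := valuation_resultant_of_roots_lt V.valuation
    (IsAlgClosed.splits (p.map φ)) (IsAlgClosed.splits (q.map φ)) (by
      intro x hx y hy
      refine valuation_root_lt_valuation_root ht hv hn hm h0 hAB ?_ ?_
      · exact eval₂_eq_zero_of_dvd_of_eval₂_eq_zero _ _ hp
          (by simpa [eval_map] using isRoot_of_mem_roots hx)
      · exact eval₂_eq_zero_of_dvd_of_eval₂_eq_zero _ _ hq
          (by simpa [eval_map] using isRoot_of_mem_roots hy))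
  rw [natDegree_map_eq_of_injective hφ, natDegree_map_eq_of_injective hφ, resultant_map_map,
    coeff_map, leadingCoeff_map_of_injective hφ, hv _ hp0, hv _ hq0, ← pow_mul, ← pow_mul,
    ← pow_add] at key
  have hR : resultant p q p.natDegree q.natDegree ≠ 0 := by
    intro hR
    rw [hR, map_zero, map_zero] at key
    exact pow_ne_zero _ ht0 key.symm
  refine ⟨hR, ?_⟩
  rw [hv _ hR] at key
  exact pow_right_injective₀ (zero_lt_one.trans ht) ht.ne' key

/-! ### Counting irreducible factors -/

theorem bigOmega_mul {K : Type*} [Field K] {p q : K[X]} (hp : p ≠ 0) (hq : q ≠ 0) :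
    bigOmega (p * q) = bigOmega p + bigOmega q := by
  rw [bigOmega, Multiset.card_eq_card_of_rel (UniqueFactorizationMonoid.factors_mul hp hq),
    Multiset.card_add, bigOmega, bigOmega]

theorem bigOmega_pos {K : Type*} [Field K] {p : K[X]} (hp : 0 < p.natDegree) :
    0 < bigOmega p := by
  have hp0 : p ≠ 0 := by
    rintro rfl
    simp at hp
  rw [bigOmega, Multiset.card_pos, ← pos_iff_ne_zero,
    UniqueFactorizationMonoid.factors_pos hp0]
  exact not_isUnit_of_natDegree_pos p hp

/-- A divisor `d` of the product splits along the factors; the part falling in each factor has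
degree at most `N`, so a nonconstant cofactor remains there and contributes to `e`. -/
theorem card_le_bigOmega_of_mul_eq_prod {K : Type*} [Field K] (N : ℕ) (s : Multiset K[X])
    (hs : ∀ r ∈ s, N < r.natDegree) :
    ∀ d e : K[X], d.natDegree ≤ N → s.prod = d * e → Multiset.card s ≤ bigOmega e := by
  induction s using Multiset.induction_on with
  | empty => simp
  | cons r s ih =>
    intro d e hd h
    have hr := hs r (Multiset.mem_cons_self r s)
    have hne : ∀ p ∈ r ::ₘ s, p ≠ 0 := by
      rintro p hp rfl
      simpa using hs _ hp
    have hprod : d * e ≠ 0 := by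
      rw [← h]
      exact Multiset.prod_ne_zero fun h0 => hne 0 h0 rfl
    rw [Multiset.prod_cons] at h
    obtain ⟨d₁, d₂, ⟨e₁, rfl⟩, ⟨e₂, h₂⟩, rfl⟩ := exists_dvd_and_dvd_of_dvd_mul (Dvd.intro e h.symm)
    have hd0 := left_ne_zero_of_mul hprod
    have he : e = e₁ * e₂ := by
      apply mul_left_cancel₀ hd0
      rw [← h, h₂]
      ring
    subst he
    have hd₁ := left_ne_zero_of_mul hd0
    have hd₂ := right_ne_zero_of_mul hd0
    have he0 := right_ne_zero_of_mul hprod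
    have he₁ := left_ne_zero_of_mul he0
    rw [natDegree_mul hd₁ hd₂] at hd
    rw [natDegree_mul hd₁ he₁] at hr
    have h1 := ih (fun r' hr' => hs r' (Multiset.mem_cons_of_mem hr')) d₂ e₂ (by omega) h₂
    have h2 : 0 < bigOmega e₁ := bigOmega_pos (by omega)
    rw [bigOmega_mul he₁ (right_ne_zero_of_mul he0), Multiset.card_cons]
    omega

theorem resultant_multiset_prod_left {R : Type*} [CommRing R] [IsDomain R] (s : Multiset R[X])
    (hs : ∀ p ∈ s, p ≠ 0) (g : R[X]) :
    resultant s.prod g s.prod.natDegree g.natDegree =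
      (s.map fun p => resultant p g p.natDegree g.natDegree).prod := by
  induction s using Multiset.induction_on with
  | empty => simp
  | cons p s ih =>
    have hs' : ∀ q ∈ s, q ≠ 0 := fun q hq => hs q (Multiset.mem_cons_of_mem hq)
    rw [Multiset.prod_cons, Multiset.map_cons, Multiset.prod_cons,
      natDegree_mul (hs p (Multiset.mem_cons_self p s))
        (Multiset.prod_ne_zero fun h => hs' 0 h rfl),
      resultant_mul_left _ _ _ _ le_rfl, ih hs']

theorem resultant_multiset_prod_right {R : Type*} [CommRing R] [IsDomain R] (f : R[X])
    (s : Multiset R[X]) (hs : ∀ p ∈ s, p ≠ 0) :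
    resultant f s.prod f.natDegree s.prod.natDegree =
      (s.map fun p => resultant f p f.natDegree p.natDegree).prod := by
  induction s using Multiset.induction_on with
  | empty => simp
  | cons p s ih =>
    have hs' : ∀ q ∈ s, q ≠ 0 := fun q hq => hs q (Multiset.mem_cons_of_mem hq)
    rw [Multiset.prod_cons, Multiset.map_cons, Multiset.prod_cons,
      natDegree_mul (hs p (Multiset.mem_cons_self p s))
        (Multiset.prod_ne_zero fun h => hs' 0 h rfl),
      resultant_mul_right _ _ _ _ le_rfl, ih hs']

/-- A factor free of `Y` would be a constant of `K` by `hf`, hence zero or a unit. -/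
theorem natDegree_pos_of_irreducible_of_dvd {K : Type*} [Field K] {f p : K[X][Y]}
    (hf : ∀ c : K[X], C c ∣ f → c.natDegree = 0) (hp : Irreducible p) (hpf : p ∣ f) :
    0 < p.natDegree := by
  rw [Nat.pos_iff_ne_zero]
  intro h
  obtain ⟨c, rfl⟩ := natDegree_eq_zero.1 h
  obtain ⟨a, rfl⟩ := natDegree_eq_zero.1 (hf c hpf)
  have ha : a ≠ 0 := by
    rintro rfl
    exact hp.ne_zero (by simp)
  exact hp.not_isUnit (((isUnit_iff_ne_zero.2 ha).map C).map C)

/-- The number of irreducible factors of `F` is bounded as soon as `R` is a product over them of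
polynomials of degree larger than that of `d`. -/
theorem isProductOfAtMost_of_natDegree_lt {K : Type*} [Field K] {F : K[X][Y]}
    (hF : 1 ≤ F.natDegree) {R d : K[X]} (hR : R ≠ 0) (hd : d ∣ R) (ρ : K[X][Y] → K[X])
    (hprod : ∀ s : Multiset K[X][Y], (∀ p ∈ s, p ≠ 0) → s.prod = F → (s.map ρ).prod = R)
    (hdeg : ∀ p, Irreducible p → p ∣ F → d.natDegree < (ρ p).natDegree) :
    IsProductOfAtMost (bigOmega (R / d)) F := by
  obtain ⟨s, hs, rfl, -⟩ := (WfDvdMonoid.not_isUnit_iff_exists_factors_eq F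
    (ne_zero_of_natDegree_gt hF)).1 (not_isUnit_of_natDegree_pos F hF)
  refine ⟨s, hs, rfl, ?_⟩
  rw [← Multiset.card_map ρ s]
  refine card_le_bigOmega_of_mul_eq_prod d.natDegree _ ?_ d _ le_rfl ?_
  · intro r hr
    obtain ⟨p, hp, rfl⟩ := Multiset.mem_map.1 hr
    exact hdeg p (hs p hp) (Multiset.dvd_prod hp)
  · rw [hprod s (fun p hp => (hs p hp).ne_zero) rfl]
    exact (EuclideanDomain.mul_div_cancel' (ne_zero_of_dvd_ne_zero hR hd) hd).symm

theorem theorem6p7 {K : Type*} [Field K] (f g : K[X][Y])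
    (hn : 1 ≤ f.natDegree) (hm : 1 ≤ g.natDegree)
    (ha0 : f.coeff 0 ≠ 0) (hb0 : g.coeff 0 ≠ 0)
    (hf : ∀ c : K[X], C c ∣ f → c.natDegree = 0)
    (hg : ∀ c : K[X], C c ∣ g → c.natDegree = 0)
    (hAB : max (highGap g : ℚ) ((highGap g : ℚ) / (g.natDegree : ℚ)) <
      min (lowGap f : ℚ) ((lowGap f : ℚ) / (f.natDegree : ℚ)))
    (d : K[X]) (hd : d ∣ resultant f g f.natDegree g.natDegree)
    (hdeg : d.natDegree <
      min (f.coeff 0).natDegree (g.coeff g.natDegree).natDegree) :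
    IsProductOfAtMost (bigOmega (resultant f g f.natDegree g.natDegree / d)) f ∧
      IsProductOfAtMost (bigOmega (resultant f g f.natDegree g.natDegree / d)) g := by
  obtain ⟨hdf, hdg⟩ := lt_min_iff.1 hdeg
  have hR := (natDegree_resultant_of_gap_lt hn hm ha0 hAB dvd_rfl dvd_rfl).1
  constructor
  · refine isProductOfAtMost_of_natDegree_lt hn hR hd
      (fun p => resultant p g p.natDegree g.natDegree) ?_ ?_
    · rintro s hs rfl
      exact (resultant_multiset_prod_left s hs g).symm
    · intro p hp hpf
      rw [(natDegree_resultant_of_gap_lt hn hm ha0 hAB hpf dvd_rfl).2]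
      exact hdg.trans_le ((Nat.le_mul_of_pos_right _
        (natDegree_pos_of_irreducible_of_dvd hf hp hpf)).trans (Nat.le_add_left _ _))
  · refine isProductOfAtMost_of_natDegree_lt hm hR hd
      (fun p => resultant f p f.natDegree p.natDegree) ?_ ?_
    · rintro s hs rfl
      exact (resultant_multiset_prod_right f s hs).symm
    · intro p hp hpg
      rw [(natDegree_resultant_of_gap_lt hn hm ha0 hAB dvd_rfl hpg).2]
      exact hdf.trans_le ((Nat.le_mul_of_pos_right _
        (natDegree_pos_of_irreducible_of_dvd hg hp hpg)).trans (Nat.le_add_right _ _))
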